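/- Let $M\ne\{0\}$ be a Hopf--von Neumann algebra, that is, a von Neumann algebra acting on a Hilbert space $H$ with a fixed orthonormal basis $\{e_\alpha\}$, together with a normal unital coassociative $*$-homomorphism $\Delta:M\to M\bar\otimes M$. The predual $M_*$ is a Banach algebra with the product $(\mu\nu)(x)=(\mu\otimes\nu)(\Delta(x))$, carries the operator space structure dual to that of $M$, and acts on $M$ by $\nu(\mu.x)=(\nu\mu)(x)$. Let $P=\{\mu\in M_*:\|\mu\|\le1,\ \mu(1)=1\}$ be the set of normal states, and for $x\in M$ let $\overline{P.x}$ be the norm closure in $M$ of $\{\mu.x:\mu\in P\}$. For $h,k\in H$ let $\mu_{kh}\in M_*$ be the functional $\mu_{kh}(x)=\langle xh,k\rangle$. For a Banach space $V$ let $H\otimes_2V$ be the space of all $\sum_\alpha e_\alpha\otimes v_\alpha$, $v_\alpha\in V$, with the norm $(\sum_\alpha\|v_\alpha\|^2)^{1/2}<\infty$, and put $h\otimes v=\sum_\alpha e_\alpha\otimes\langle h,e_\alpha\rangle v$ and $\langle \sum_\alpha e_\alpha\otimes v_\alpha,\bar k\otimes\eta\rangle=\sum_\alpha\langle e_\alpha,k\rangle\langle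 v_\alpha,\eta\rangle$ for $h,k\in H$, $v\in V$, $\eta\in V^*$. A left covariant representation of $M_*$ on $V$ is a pair $(\pi,\xi)$ of a contractive homomorphism $\pi:M_*\to B(V)$ and a contractive linear map $\xi:M_*\to V$ with $\xi(\mu\nu)=\pi(\mu)\xi(\nu)$ for all $\mu,\nu\in M_*$. The map $\pi$ is $\ell_2$-contractive if $\|(\pi(u_{ij}))\|_{B(\ell_{2,n}\otimes_2V)}\le\|(u_{ij})\|_{M_n(M_*)}$ for all $n$ and all $(u_{ij})\in M_n(M_*)$; a generator of $\pi$ is an operator $U\in B(H\otimes_2V)$ with $\langle U(h\otimes v),\bar k\otimes\eta\rangle=\langle\pi(\mu_{kh})v,\eta\rangle$ for all $h,k\in H$, $v\in V$, $\eta\in V^*$. Let $WAP_{iso,l}(M)$ be the set of all $x\in M$ for which there are a reflexive Banach space $V$, a left covariant representation $(\pi,\xi)$ of $M_*$ on $V$ such that $\pi$ is $\ell_2$-contractive and has a generator that is isometric and onto, and an $\eta\in V^*$, with $\mu(x)=\langle\xi(\mu),\eta\rangle$ for all $\mu\in M_*$. Then for every $x\in WAP_{iso,l}(M)$ there is a constant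 $c\in\mathbb C$ such that $c1\in\overline{P.x}$. -/

import Mathlib

open scoped TensorProduct InnerProductSpace ENNReal

universe u v w

set_option linter.unusedSectionVars false

noncomputable section

namespace HopfVN

/-! ### Von Neumann algebras and their preduals -/

section Algebra

variable {H : Type u} [NormedAddCommGroup H] [InnerProductSpace ℂ H] [CompleteSpace H]

instance instSMulMemClass : SMulMemClass (VonNeumannAlgebra H) ℂ (H →L[ℂ] H) where
  smul_mem {s} c _ hx := s.toStarSubalgebra.smul_mem hx c

instance instIsClosed (M : VonNeumannAlgebra H) : IsClosed (M : Set (H →L[ℂ] H)) := by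
  rw [← M.centralizer_centralizer]
  exact Set.isClosed_centralizer _

/-- The inclusion of `M` in `B(H)` as a bounded linear map. -/
def inclusion (M : VonNeumannAlgebra H) : M →L[ℂ] (H →L[ℂ] H) :=
  LinearMap.mkContinuous
    { toFun := fun x => (x : H →L[ℂ] H), map_add' := fun _ _ => rfl, map_smul' := fun _ _ => rfl }
    1 (fun x => by simp)

/-- The vector functional `μ_{k,h} : x ↦ ⟨x h, k⟩` on `M`; the Hilbert space inner product of
the text is linear in its first variable, Mathlib's in the second. -/
def vectorFunctional (M : VonNeumannAlgebra H) (k h : H) : StrongDual ℂ M :=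
  (innerSL ℂ k) ∘L (ContinuousLinearMap.apply ℂ H h) ∘L inclusion M

/-- The normal functionals on `M`: the norm closure in the Banach dual of `M` of the linear span of
the vector functionals. -/
def normalFunctionals (M : VonNeumannAlgebra H) : Submodule ℂ (StrongDual ℂ M) :=
  (Submodule.span ℂ (Set.range fun p : H × H => vectorFunctional M p.1 p.2)).topologicalClosure

theorem vectorFunctional_mem (M : VonNeumannAlgebra H) (k h : H) :
    vectorFunctional M k h ∈ normalFunctionals M :=
  Submodule.le_topologicalClosure _ (Submodule.subset_span ⟨(k, h), rfl⟩)

/-- The predual `M_*`: the Banach space of normal functionals on `M`, with the norm of the dual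
of `M`. -/
def Predual (M : VonNeumannAlgebra H) : Type u := normalFunctionals M

instance (M : VonNeumannAlgebra H) : NormedAddCommGroup (Predual M) :=
  inferInstanceAs (NormedAddCommGroup (normalFunctionals M))

instance (M : VonNeumannAlgebra H) : NormedSpace ℂ (Predual M) :=
  inferInstanceAs (NormedSpace ℂ (normalFunctionals M))

instance (M : VonNeumannAlgebra H) : CompleteSpace (Predual M) :=
  (Submodule.isClosed_topologicalClosure _).completeSpace_coe

/-- The inclusion of the predual in the Banach dual. -/
def toDual {M : VonNeumannAlgebra H} : Predual M →ₗᵢ[ℂ] StrongDual ℂ M :=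
  (normalFunctionals M).subtypeₗᵢ

theorem toDual_mem {M : VonNeumannAlgebra H} (μ : Predual M) : toDual μ ∈ normalFunctionals M :=
  μ.2

/-- The vector functional `μ_{k,h}` as an element of the predual. -/
def vectorNormal (M : VonNeumannAlgebra H) (k h : H) : Predual M :=
  ⟨vectorFunctional M k h, vectorFunctional_mem M k h⟩

/-- The normal states of `M`. -/
def normalStates (M : VonNeumannAlgebra H) : Set (Predual M) :=
  {μ | ‖μ‖ ≤ 1 ∧ toDual μ 1 = 1}

/-- The von Neumann algebra `(S ∪ S*)''` generated by a set of operators. -/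
def generated (S : Set (H →L[ℂ] H)) : VonNeumannAlgebra H where
  toStarSubalgebra :=
    StarSubalgebra.centralizer ℂ (StarSubalgebra.centralizer ℂ S : Set (H →L[ℂ] H))
  centralizer_centralizer' := by simp

end Algebra

/-! ### The Hilbert space `H ⊗ H` and the algebra `M ⊗̄ M` -/

section Tensor

variable {H : Type u} [NormedAddCommGroup H] [InnerProductSpace ℂ H] [CompleteSpace H]

variable (H) in
/-- The Hilbert space tensor product `H ⊗ H`. -/
abbrev HilbertTensor : Type u := UniformSpace.Completion (H ⊗[ℂ] H)

/-- The map `k ↦ h ⊗ k`. -/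
def tensorLeft (h : H) : H →L[ℂ] HilbertTensor H :=
  (UniformSpace.Completion.toComplL : (H ⊗[ℂ] H) →L[ℂ] HilbertTensor H) ∘L
    (TensorProduct.mkL ℂ H H h)

/-- The map `h ↦ h ⊗ k`. -/
def tensorRight (k : H) : H →L[ℂ] HilbertTensor H :=
  (UniformSpace.Completion.toComplL : (H ⊗[ℂ] H) →L[ℂ] HilbertTensor H) ∘L
    ((TensorProduct.mkL ℂ H H).flip k)

/-- The elementary tensor `h ⊗ k` in `H ⊗ H`. -/
def elemTensor (h k : H) : HilbertTensor H := ((h ⊗ₜ[ℂ] k : H ⊗[ℂ] H) : HilbertTensor H)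

/-- The operator `x ⊗ y` on `H ⊗ H`. -/
def opTensor (x y : H →L[ℂ] H) : HilbertTensor H →L[ℂ] HilbertTensor H :=
  ((UniformSpace.Completion.toComplL : (H ⊗[ℂ] H) →L[ℂ] HilbertTensor H) ∘L
    TensorProduct.mapL x y).extend
      (UniformSpace.Completion.toComplL : (H ⊗[ℂ] H) →L[ℂ] HilbertTensor H)

/-- The von Neumann algebra tensor product `M ⊗̄ M`. -/
def tensorAlgebra (M : VonNeumannAlgebra H) : VonNeumannAlgebra (HilbertTensor H) :=
  generated {T | ∃ x ∈ M, ∃ y ∈ M, T = opTensor x y}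

theorem tensorLeft_apply (h k : H) : tensorLeft h k = elemTensor h k := rfl

theorem tensorRight_apply (h k : H) : tensorRight k h = elemTensor h k := rfl

theorem opTensor_elemTensor (x y : H →L[ℂ] H) (h k : H) :
    opTensor x y (elemTensor h k) = elemTensor (x h) (y k) :=
  ContinuousLinearMap.extend_eq
    (e := (UniformSpace.Completion.toComplL : (H ⊗[ℂ] H) →L[ℂ] HilbertTensor H)) _
    UniformSpace.Completion.denseRange_coe
    (UniformSpace.Completion.isUniformInducing_coe _) (h ⊗ₜ[ℂ] k)

theorem inner_elemTensor (h k h' k' : H) :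
    ⟪elemTensor h k, elemTensor h' k'⟫_ℂ = ⟪h, h'⟫_ℂ * ⟪k, k'⟫_ℂ := by
  simp [elemTensor]

theorem norm_elemTensor (h k : H) : ‖elemTensor h k‖ = ‖h‖ * ‖k‖ := by
  simp [elemTensor]

theorem tensor_ext {G : Type v} [NormedAddCommGroup G] [NormedSpace ℂ G]
    {S T : HilbertTensor H →L[ℂ] G}
    (hST : ∀ h k : H, S (elemTensor h k) = T (elemTensor h k)) : S = T := by
  ext z
  induction z using UniformSpace.Completion.induction_on with
  | hp => exact isClosed_eq S.continuous T.continuous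
  | ih a =>
    induction a using TensorProduct.induction_on with
    | zero => exact (map_zero S).trans (map_zero T).symm
    | tmul h k => exact hST h k
    | add a b ha hb => rw [UniformSpace.Completion.coe_add, map_add, map_add, ha, hb]

theorem opTensor_mul (x y x' y' : H →L[ℂ] H) :
    opTensor x y * opTensor x' y' = opTensor (x * x') (y * y') :=
  tensor_ext fun h k => by simp [opTensor_elemTensor]

theorem star_opTensor (x y : H →L[ℂ] H) : star (opTensor x y) = opTensor (star x) (star y) := by
  refine tensor_ext fun h k => ?_
  have : innerSL ℂ (star (opTensor x y) (elemTensor h k)) =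
      innerSL ℂ (opTensor (star x) (star y) (elemTensor h k)) := tensor_ext fun h' k' => by
    simp [ContinuousLinearMap.star_eq_adjoint, ContinuousLinearMap.adjoint_inner_left,
      opTensor_elemTensor, inner_elemTensor]
  exact innerSL_inj.1 this

theorem opTensor_comm_of_mem {M : VonNeumannAlgebra H} {T : HilbertTensor H →L[ℂ] HilbertTensor H}
    (hT : T ∈ tensorAlgebra M) {a b : H →L[ℂ] H} (ha : a ∈ M.commutant) (hb : b ∈ M.commutant) :
    opTensor a b * T = T * opTensor a b := by
  have key : ∀ a b : H →L[ℂ] H, a ∈ M.commutant → b ∈ M.commutant → ∀ x ∈ M, ∀ y ∈ M,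
      opTensor x y * opTensor a b = opTensor a b * opTensor x y := by
    intro a b ha hb x hx y hy
    rw [VonNeumannAlgebra.mem_commutant_iff] at ha hb
    rw [opTensor_mul, opTensor_mul, ha x hx, hb y hy]
  have hmem : opTensor a b ∈ StarSubalgebra.centralizer ℂ
      {T | ∃ x ∈ M, ∃ y ∈ M, T = opTensor x y} := by
    rw [StarSubalgebra.mem_centralizer_iff]
    rintro _ ⟨x, hx, y, hy, rfl⟩
    refine ⟨key a b ha hb x hx y hy, ?_⟩
    rw [star_opTensor]
    exact key a b ha hb _ (star_mem hx) _ (star_mem hy)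
  exact ((StarSubalgebra.mem_centralizer_iff ℂ).1 hT _ hmem).1

/-! ### Slice maps -/

/-- The slice `(μ_{k,h} ⊗ id)(T)` of an operator `T` on `H ⊗ H`, defined by
`⟨(μ_{k,h} ⊗ id)(T) u, v⟩ = ⟨T (h ⊗ u), k ⊗ v⟩`. -/
def vecSliceLeft (k h : H) (T : HilbertTensor H →L[ℂ] HilbertTensor H) : H →L[ℂ] H :=
  (tensorLeft k).adjoint ∘L T ∘L tensorLeft h

/-- The slice `(id ⊗ μ_{k,h})(T)` of an operator `T` on `H ⊗ H`, defined by
`⟨(id ⊗ μ_{k,h})(T) u, v⟩ = ⟨T (u ⊗ h), v ⊗ k⟩`. -/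
def vecSliceRight (k h : H) (T : HilbertTensor H →L[ℂ] HilbertTensor H) : H →L[ℂ] H :=
  (tensorRight k).adjoint ∘L T ∘L tensorRight h

theorem inner_vecSliceLeft (k h u v : H) (T : HilbertTensor H →L[ℂ] HilbertTensor H) :
    ⟪v, vecSliceLeft k h T u⟫_ℂ = ⟪elemTensor k v, T (elemTensor h u)⟫_ℂ := by
  simp [vecSliceLeft, ContinuousLinearMap.adjoint_inner_right, tensorLeft_apply]

theorem inner_vecSliceRight (k h u v : H) (T : HilbertTensor H →L[ℂ] HilbertTensor H) :
    ⟪v, vecSliceRight k h T u⟫_ℂ = ⟪elemTensor v k, T (elemTensor u h)⟫_ℂ := by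
  simp [vecSliceRight, ContinuousLinearMap.adjoint_inner_right, tensorRight_apply]

theorem norm_vecSliceLeft_le (k h : H) (T : HilbertTensor H →L[ℂ] HilbertTensor H) :
    ‖vecSliceLeft k h T‖ ≤ ‖T‖ * ‖k‖ * ‖h‖ := by
  have hb : ∀ z : H, ‖tensorLeft z‖ ≤ ‖z‖ := fun z =>
    ContinuousLinearMap.opNorm_le_bound _ (norm_nonneg _) fun u => by
      rw [tensorLeft_apply, norm_elemTensor]
  calc ‖vecSliceLeft k h T‖ ≤ ‖(tensorLeft k).adjoint‖ * ‖T ∘L tensorLeft h‖ :=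
        ContinuousLinearMap.opNorm_comp_le _ _
    _ ≤ ‖k‖ * (‖T‖ * ‖h‖) := by
        gcongr
        · rw [LinearIsometryEquiv.norm_map]; exact hb k
        · exact (ContinuousLinearMap.opNorm_comp_le _ _).trans (by gcongr; exact hb h)
    _ = ‖T‖ * ‖k‖ * ‖h‖ := by ring

theorem mem_of_inner_comm {M : VonNeumannAlgebra H} {S : H →L[ℂ] H}
    (hS : ∀ a ∈ M.commutant, ∀ u v : H, ⟪v, S (a u)⟫_ℂ = ⟪star a v, S u⟫_ℂ) : S ∈ M := by
  rw [← M.commutant_commutant, VonNeumannAlgebra.mem_commutant_iff]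
  intro a ha
  ext u
  refine ext_inner_left ℂ fun v => ?_
  have := hS a ha u v
  rw [ContinuousLinearMap.star_eq_adjoint, ContinuousLinearMap.adjoint_inner_left] at this
  simpa using this.symm

theorem vecSliceLeft_mem {M : VonNeumannAlgebra H} {T : HilbertTensor H →L[ℂ] HilbertTensor H}
    (hT : T ∈ tensorAlgebra M) (k h : H) : vecSliceLeft k h T ∈ M := by
  refine mem_of_inner_comm fun a ha u v => ?_
  have hc := opTensor_comm_of_mem hT (one_mem M.commutant) ha
  have h1 : elemTensor h (a u) = opTensor 1 a (elemTensor h u) := by simp [opTensor_elemTensor]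
  have h2 : elemTensor k (star a v) = star (opTensor 1 a) (elemTensor k v) := by
    simp [star_opTensor, opTensor_elemTensor]
  rw [inner_vecSliceLeft, inner_vecSliceLeft, h1, h2, ContinuousLinearMap.star_eq_adjoint,
    ContinuousLinearMap.adjoint_inner_left]
  exact congrArg (fun S => ⟪elemTensor k v, S (elemTensor h u)⟫_ℂ) hc.symm

theorem vecSliceRight_mem {M : VonNeumannAlgebra H} {T : HilbertTensor H →L[ℂ] HilbertTensor H}
    (hT : T ∈ tensorAlgebra M) (k h : H) : vecSliceRight k h T ∈ M := by
  refine mem_of_inner_comm fun a ha u v => ?_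
  have hc := opTensor_comm_of_mem hT ha (one_mem M.commutant)
  have h1 : elemTensor (a u) h = opTensor a 1 (elemTensor u h) := by simp [opTensor_elemTensor]
  have h2 : elemTensor (star a v) k = star (opTensor a 1) (elemTensor v k) := by
    simp [star_opTensor, opTensor_elemTensor]
  rw [inner_vecSliceRight, inner_vecSliceRight, h1, h2, ContinuousLinearMap.star_eq_adjoint,
    ContinuousLinearMap.adjoint_inner_left]
  exact congrArg (fun S => ⟪elemTensor v k, S (elemTensor u h)⟫_ℂ) hc.symm

/-- `(μ_{k,h} ⊗ id)(T)` as an element of `M`, for `T ∈ M ⊗̄ M`. -/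
def sliceVecLeft (M : VonNeumannAlgebra H) (k h : H) (T : tensorAlgebra M) : M :=
  ⟨vecSliceLeft k h T, vecSliceLeft_mem T.2 k h⟩

/-- `(id ⊗ μ_{k,h})(T)` as an element of `M`, for `T ∈ M ⊗̄ M`. -/
def sliceVecRight (M : VonNeumannAlgebra H) (k h : H) (T : tensorAlgebra M) : M :=
  ⟨vecSliceRight k h T, vecSliceRight_mem T.2 k h⟩

/-- The bounded sesquilinear form `(k, h) ↦ μ((μ_{k,h} ⊗ id)(T))`. -/
def sliceForm {M : VonNeumannAlgebra H} (μ : StrongDual ℂ M) (T : tensorAlgebra M) :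
    H →L⋆[ℂ] H →L[ℂ] ℂ :=
  LinearMap.mkContinuous₂
    (LinearMap.mk₂'ₛₗ (starRingEnd ℂ) (RingHom.id ℂ) (fun k h => μ (sliceVecLeft M k h T))
      (by
        intro k k' h
        rw [← map_add]; congr 1; apply Subtype.ext
        simp [sliceVecLeft, vecSliceLeft, tensorLeft, ContinuousLinearMap.add_comp])
      (by
        intro c k h
        rw [← map_smul]; congr 1; apply Subtype.ext
        simp only [sliceVecLeft, vecSliceLeft, tensorLeft, map_smul,
          ContinuousLinearMap.comp_smul, map_smulₛₗ]
        rfl)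
      (by
        intro k h h'
        rw [← map_add]; congr 1; apply Subtype.ext
        simp [sliceVecLeft, vecSliceLeft, tensorLeft])
      (by
        intro c k h
        rw [RingHom.id_apply, ← map_smul]; congr 1; apply Subtype.ext
        simp [sliceVecLeft, vecSliceLeft, tensorLeft]))
    (‖μ‖ * ‖T‖) (by
      intro k h
      calc ‖μ (sliceVecLeft M k h T)‖ ≤ ‖μ‖ * ‖sliceVecLeft M k h T‖ := μ.le_opNorm _
        _ ≤ ‖μ‖ * (‖T‖ * ‖k‖ * ‖h‖) := by
            gcongr
            exact norm_vecSliceLeft_le k h (T : HilbertTensor H →L[ℂ] HilbertTensor H)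
        _ = ‖μ‖ * ‖T‖ * ‖k‖ * ‖h‖ := by ring)

theorem norm_sliceForm_le {M : VonNeumannAlgebra H} (μ : StrongDual ℂ M) (T : tensorAlgebra M)
    (k h : H) : ‖sliceForm μ T k h‖ ≤ ‖μ‖ * ‖T‖ * ‖k‖ * ‖h‖ :=
  (ContinuousLinearMap.le_opNorm₂ _ k h).trans (by
    gcongr
    exact LinearMap.mkContinuous₂_norm_le _ (by positivity) _)

/-- The operator `(id ⊗ μ)(T)`, `T ∈ M ⊗̄ M`, determined by
`⟨(id ⊗ μ)(T) h, k⟩ = μ((μ_{k,h} ⊗ id)(T))` for all `h, k ∈ H`. -/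
def sliceOp {M : VonNeumannAlgebra H} (μ : StrongDual ℂ M) (T : tensorAlgebra M) : H →L[ℂ] H :=
  (InnerProductSpace.continuousLinearMapOfBilin (sliceForm μ T)).adjoint

theorem inner_sliceOp {M : VonNeumannAlgebra H} (μ : StrongDual ℂ M) (T : tensorAlgebra M)
    (k h : H) : ⟪k, sliceOp μ T h⟫_ℂ = μ (sliceVecLeft M k h T) := by
  rw [sliceOp, ContinuousLinearMap.adjoint_inner_right,
    InnerProductSpace.continuousLinearMapOfBilin_apply]
  rfl

theorem norm_sliceOp_le {M : VonNeumannAlgebra H} (μ : StrongDual ℂ M) (T : tensorAlgebra M) :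
    ‖sliceOp μ T‖ ≤ ‖μ‖ * ‖T‖ := by
  refine (LinearIsometryEquiv.norm_map _ _).le.trans ?_
  refine ContinuousLinearMap.opNorm_le_bound _ (by positivity) fun k => ?_
  change ‖(InnerProductSpace.toDual ℂ H).symm (sliceForm μ T k)‖ ≤ _
  rw [LinearIsometryEquiv.norm_map]
  exact ContinuousLinearMap.opNorm_le_bound _ (by positivity) fun h => norm_sliceForm_le μ T k h

theorem sliceOp_mem {M : VonNeumannAlgebra H} (μ : StrongDual ℂ M) (T : tensorAlgebra M) :
    sliceOp μ T ∈ M := by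
  refine mem_of_inner_comm fun a ha u v => ?_
  rw [inner_sliceOp, inner_sliceOp]
  congr 1
  apply Subtype.ext
  have hc := opTensor_comm_of_mem T.2 ha (one_mem M.commutant)
  ext p
  refine ext_inner_left ℂ fun q => ?_
  have h1 : elemTensor (a u) p = opTensor a 1 (elemTensor u p) := by simp [opTensor_elemTensor]
  have h2 : elemTensor (star a v) q = star (opTensor a 1) (elemTensor v q) := by
    simp [star_opTensor, opTensor_elemTensor]
  simp only [sliceVecLeft]
  rw [inner_vecSliceLeft, inner_vecSliceLeft, h1, h2, ContinuousLinearMap.star_eq_adjoint,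
    ContinuousLinearMap.adjoint_inner_left]
  exact congrArg (fun S => ⟪elemTensor v q, S (elemTensor u p)⟫_ℂ) hc.symm

/-- The slice map `id ⊗ μ : M ⊗̄ M → M`. -/
def slice {M : VonNeumannAlgebra H} (μ : StrongDual ℂ M) : tensorAlgebra M →L[ℂ] M :=
  LinearMap.mkContinuous
    { toFun := fun T => ⟨sliceOp μ T, sliceOp_mem μ T⟩
      map_add' := fun S T => by
        apply Subtype.ext
        ext h
        refine ext_inner_left ℂ fun k => ?_
        change ⟪k, sliceOp μ (S + T) h⟫_ℂ = ⟪k, sliceOp μ S h + sliceOp μ T h⟫_ℂ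
        rw [inner_add_right, inner_sliceOp, inner_sliceOp, inner_sliceOp, ← map_add]
        congr 1
        apply Subtype.ext
        simp [sliceVecLeft, vecSliceLeft, ContinuousLinearMap.add_comp]
      map_smul' := fun c T => by
        apply Subtype.ext
        ext h
        refine ext_inner_left ℂ fun k => ?_
        change ⟪k, sliceOp μ (c • T) h⟫_ℂ = ⟪k, c • sliceOp μ T h⟫_ℂ
        rw [inner_smul_right, inner_sliceOp, inner_sliceOp, ← smul_eq_mul, ← map_smul]
        congr 1
        apply Subtype.ext
        simp [sliceVecLeft, vecSliceLeft] }
    ‖μ‖ (fun T => norm_sliceOp_le μ T)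

theorem norm_slice_le {M : VonNeumannAlgebra H} (μ : StrongDual ℂ M) (T : tensorAlgebra M) :
    ‖slice μ T‖ ≤ ‖μ‖ * ‖T‖ := norm_sliceOp_le μ T

theorem inner_slice {M : VonNeumannAlgebra H} (μ : StrongDual ℂ M) (T : tensorAlgebra M)
    (k h : H) : ⟪k, (slice μ T : H →L[ℂ] H) h⟫_ℂ = μ (sliceVecLeft M k h T) :=
  inner_sliceOp μ T k h

theorem ext_of_inner {M : VonNeumannAlgebra H} {x y : M}
    (hxy : ∀ k h : H, ⟪k, (x : H →L[ℂ] H) h⟫_ℂ = ⟪k, (y : H →L[ℂ] H) h⟫_ℂ) : x = y := by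
  apply Subtype.ext
  ext h
  exact ext_inner_left ℂ fun k => hxy k h

theorem slice_add {M : VonNeumannAlgebra H} (μ ν : StrongDual ℂ M) :
    slice (μ + ν) = slice μ + slice ν := by
  ext1 T
  refine ext_of_inner fun k h => ?_
  change _ = ⟪k, (slice μ T : H →L[ℂ] H) h + (slice ν T : H →L[ℂ] H) h⟫_ℂ
  rw [inner_add_right, inner_slice, inner_slice, inner_slice]
  rfl

theorem slice_smul {M : VonNeumannAlgebra H} (c : ℂ) (μ : StrongDual ℂ M) :
    slice (c • μ) = c • slice μ := by
  ext1 T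
  refine ext_of_inner fun k h => ?_
  change _ = ⟪k, c • (slice μ T : H →L[ℂ] H) h⟫_ℂ
  rw [inner_smul_right, inner_slice, inner_slice]
  rfl

end Tensor

/-! ### Hopf--von Neumann algebras -/

section Hopf

variable {H : Type u} [NormedAddCommGroup H] [InnerProductSpace ℂ H] [CompleteSpace H]

/-- A comultiplication on `M`: a normal unital coassociative *-homomorphism `Δ : M → M ⊗̄ M`.
The field `coassoc` is the equality `(Δ ⊗ id) Δ(x) = (id ⊗ Δ) Δ(x)` of operators on `H ⊗ H ⊗ H`,
written through the matrix coefficients of both sides at the elementary tensors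
`h₁ ⊗ h₂ ⊗ h₃` and `k₁ ⊗ k₂ ⊗ k₃`: for `T ∈ M ⊗̄ M`,
`⟨(Δ ⊗ id)(T) (h₁ ⊗ h₂ ⊗ h₃), k₁ ⊗ k₂ ⊗ k₃⟩ = ⟨Δ((id ⊗ μ_{k₃,h₃})(T)) (h₁ ⊗ h₂), k₁ ⊗ k₂⟩` and
`⟨(id ⊗ Δ)(T) (h₁ ⊗ h₂ ⊗ h₃), k₁ ⊗ k₂ ⊗ k₃⟩ = ⟨Δ((μ_{k₁,h₁} ⊗ id)(T)) (h₂ ⊗ h₃), k₂ ⊗ k₃⟩`. -/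
structure Comultiplication (M : VonNeumannAlgebra H) where
  /-- The unital *-homomorphism `Δ`. -/
  toHom : M →⋆ₐ[ℂ] tensorAlgebra M
  /-- `Δ` is normal: it pulls back normal functionals to normal functionals. -/
  normal : ∀ ω ∈ normalFunctionals (tensorAlgebra M), ∃ ρ ∈ normalFunctionals M, ∀ x : M, ρ x = ω (toHom x)
  coassoc : ∀ (x : M) (h₁ h₂ h₃ k₁ k₂ k₃ : H),
    ⟪elemTensor k₁ k₂, (toHom (sliceVecRight M k₃ h₃ (toHom x)) :
        HilbertTensor H →L[ℂ] HilbertTensor H) (elemTensor h₁ h₂)⟫_ℂ =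
      ⟪elemTensor k₂ k₃, (toHom (sliceVecLeft M k₁ h₁ (toHom x)) :
        HilbertTensor H →L[ℂ] HilbertTensor H) (elemTensor h₂ h₃)⟫_ℂ

variable {M : VonNeumannAlgebra H}

/-- `Δ` as a bounded linear map. -/
def Comultiplication.toCLM (Δ : Comultiplication M) : M →L[ℂ] tensorAlgebra M :=
  LinearMap.mkContinuous
    { toFun := Δ.toHom, map_add' := map_add Δ.toHom, map_smul' := map_smul Δ.toHom } 1
    fun x => by
      rw [one_mul]
      exact NonUnitalStarAlgHom.norm_apply_le Δ.toHom x

/-- The functional `μ ν = (μ ⊗ ν) ∘ Δ` on `M`, where `μ ⊗ ν = μ ∘ (id ⊗ ν)`. -/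
def convDual (Δ : Comultiplication M) (μ ν : StrongDual ℂ M) : StrongDual ℂ M :=
  μ ∘L slice ν ∘L Δ.toCLM

theorem convDual_vector_mem (Δ : Comultiplication M) (k h k' h' : H) :
    convDual Δ (vectorFunctional M k h) (vectorFunctional M k' h') ∈ normalFunctionals M := by
  obtain ⟨ρ, hρ, hx⟩ := Δ.normal
    (vectorFunctional (tensorAlgebra M) (elemTensor k k') (elemTensor h h'))
    (vectorFunctional_mem _ _ _)
  convert hρ
  ext x
  rw [hx]
  change ⟪k, (slice (vectorFunctional M k' h') (Δ.toHom x) : H →L[ℂ] H) h⟫_ℂ = _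
  rw [inner_slice]
  exact inner_vecSliceLeft k h h' k' _

theorem convDual_mem (Δ : Comultiplication M) {μ ν : StrongDual ℂ M} (hμ : μ ∈ normalFunctionals M)
    (hν : ν ∈ normalFunctionals M) : convDual Δ μ ν ∈ normalFunctionals M := by
  have hcl : IsClosed (normalFunctionals M : Set (StrongDual ℂ M)) := Submodule.isClosed_topologicalClosure _
  let L : StrongDual ℂ M →L[ℂ] StrongDual ℂ M →L[ℂ] StrongDual ℂ M :=
    LinearMap.mkContinuous₂
      (LinearMap.mk₂ ℂ (convDual Δ) (fun _ _ _ => rfl) (fun _ _ _ => rfl)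
        (fun μ ν ν' => by simp [convDual, slice_add]) (fun c μ ν => by simp [convDual, slice_smul]))
      ‖Δ.toCLM‖ (fun μ ν => by
        refine ContinuousLinearMap.opNorm_le_bound _ (by positivity) fun x => ?_
        calc ‖μ (slice ν (Δ.toCLM x))‖ ≤ ‖μ‖ * (‖ν‖ * (‖Δ.toCLM‖ * ‖x‖)) :=
              (μ.le_opNorm _).trans (by
                gcongr
                exact (norm_slice_le ν _).trans (by gcongr; exact Δ.toCLM.le_opNorm x))
          _ = ‖Δ.toCLM‖ * ‖μ‖ * ‖ν‖ * ‖x‖ := by ring)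
  have hspan : ∀ {N : Submodule ℂ (StrongDual ℂ M)}, IsClosed (N : Set (StrongDual ℂ M)) →
      (∀ k h, vectorFunctional M k h ∈ N) → normalFunctionals M ≤ N := fun hN h =>
    Submodule.topologicalClosure_minimal _ (Submodule.span_le.2 (by rintro _ ⟨p, rfl⟩; exact h _ _))
      hN
  have step1 : ∀ k h, ∀ ν ∈ normalFunctionals M, L (vectorFunctional M k h) ν ∈ normalFunctionals M := fun k h ν hν =>
    hspan (N := (normalFunctionals M).comap (L (vectorFunctional M k h)).toLinearMap)
      (hcl.preimage (L _).continuous) (fun k' h' => convDual_vector_mem Δ k h k' h') hν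
  exact hspan (N := (normalFunctionals M).comap (L.flip ν).toLinearMap)
    (hcl.preimage (L.flip ν).continuous) (fun k h => step1 k h ν hν) hμ

/-- The product of `M_*`: `(μ ν)(x) = (μ ⊗ ν)(Δ(x))`. -/
def conv (Δ : Comultiplication M) (μ ν : Predual M) : Predual M :=
  ⟨convDual Δ (toDual μ) (toDual ν), convDual_mem Δ (toDual_mem μ) (toDual_mem ν)⟩

/-- The left action of `M_*` on `M`: `μ.x = (id ⊗ μ)(Δ(x))`, so that `ν(μ.x) = (ν μ)(x)`. -/
def act (Δ : Comultiplication M) (μ : Predual M) (x : M) : M :=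
  slice (toDual μ) (Δ.toHom x)

theorem apply_act (Δ : Comultiplication M) (μ ν : Predual M) (x : M) :
    toDual ν (act Δ μ x) = toDual (conv Δ ν μ) x := rfl

/-- The orbit `P.x` of `x` under the normal states. -/
def stateOrbit (Δ : Comultiplication M) (x : M) : Set M :=
  {y | ∃ μ ∈ normalStates M, y = act Δ μ x}

end Hopf

/-! ### Representations on Banach spaces -/

section Representations

variable {H : Type u} [NormedAddCommGroup H] [InnerProductSpace ℂ H] [CompleteSpace H]
  {M : VonNeumannAlgebra H}

/-- A Banach space is reflexive if its canonical embedding in the bidual is onto. -/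
def IsReflexive (V : Type w) [NormedAddCommGroup V] [NormedSpace ℂ V] : Prop :=
  Function.Surjective (NormedSpace.inclusionInDoubleDual ℂ V)

/-- A left covariant representation `(π, ξ)` of `M_*` on `V`. -/
structure LeftCovariantRep (Δ : Comultiplication M) (V : Type w) [NormedAddCommGroup V]
    [NormedSpace ℂ V] where
  π : Predual M →L[ℂ] (V →L[ℂ] V)
  ξ : Predual M →L[ℂ] V
  norm_π_le : ‖π‖ ≤ 1
  π_mul : ∀ μ ν, π (conv Δ μ ν) = π μ * π ν
  norm_ξ_le : ‖ξ‖ ≤ 1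
  covariant : ∀ μ ν, ξ (conv Δ μ ν) = π μ (ξ ν)

/-- The operator on `ℓ_{2,n} ⊗₂ E` with the operator matrix `A`: its value at `(v_k)` has the
coordinates `∑_k A_{jk} v_k`. -/
def matrixOp {E : Type w} [NormedAddCommGroup E] [NormedSpace ℂ E] {n : ℕ}
    (A : Matrix (Fin n) (Fin n) (E →L[ℂ] E)) :
    PiLp 2 (fun _ : Fin n => E) →L[ℂ] PiLp 2 (fun _ : Fin n => E) :=
  (PiLp.continuousLinearEquiv 2 ℂ (fun _ : Fin n => E)).symm.toContinuousLinearMap ∘L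
    (ContinuousLinearMap.pi fun j => ∑ k, A j k ∘L ContinuousLinearMap.proj k) ∘L
    (PiLp.continuousLinearEquiv 2 ℂ (fun _ : Fin n => E)).toContinuousLinearMap

theorem matrixOp_apply {E : Type w} [NormedAddCommGroup E] [NormedSpace ℂ E] {n : ℕ}
    (A : Matrix (Fin n) (Fin n) (E →L[ℂ] E)) (v : PiLp 2 (fun _ : Fin n => E)) (j : Fin n) :
    matrixOp A v j = ∑ k, A j k (v k) := by
  simp [matrixOp]

/-- The norm of `u ∈ M_n(M_*)` in the operator space structure dual to that of `M`: the supremum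
of the norms of the `n² × n²` scalar matrices `(u_{ij}(x_{kl}))` over `x` in the unit ball of
`M_n(M)`, where `M_n(M)` acts on `H^n`. -/
def dualMatrixNorm {n : ℕ} (u : Matrix (Fin n) (Fin n) (Predual M)) : ℝ≥0∞ :=
  ⨆ (x : Matrix (Fin n) (Fin n) M) (_ : ‖matrixOp (x.map fun y => (y : H →L[ℂ] H))‖ ≤ 1),
    ‖Matrix.toEuclideanCLM (n := Fin n × Fin n) (𝕜 := ℂ)
      (Matrix.of fun p q => toDual (u p.1 q.1) (x p.2 q.2))‖ₑ

/-- A linear map `π : M_* → B(V)` is `ℓ₂`-contractive if its amplifications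
`M_n(M_*) → M_n(B(V)) = B(ℓ_{2,n} ⊗₂ V)` are contractive for all `n`. -/
def IsL2Contractive {V : Type w} [NormedAddCommGroup V] [NormedSpace ℂ V]
    (π : Predual M →L[ℂ] (V →L[ℂ] V)) : Prop :=
  ∀ (n : ℕ) (u : Matrix (Fin n) (Fin n) (Predual M)),
    ‖matrixOp (u.map fun μ => π μ)‖ₑ ≤ dualMatrixNorm u

variable {ι : Type v} (b : HilbertBasis ι ℂ H) {V : Type w} [NormedAddCommGroup V]
  [NormedSpace ℂ V]

variable (ι V) in
/-- The space `H ⊗₂ V = ℓ₂(ι; V)`, where `ι` indexes the fixed orthonormal basis `b` of `H`: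
the family `(v_α)` stands for `∑_α b_α ⊗ v_α`. -/
abbrev EllTwo : Type (max v w) := lp (fun _ : ι => V) 2

theorem memlp_tmul (h : H) (v : V) : Memℓp (fun α => b.repr h α • v) 2 := by
  have := lp.memℓp (b.repr h)
  rw [memℓp_gen_iff (by norm_num)] at this ⊢
  simp only [norm_smul]
  refine (this.mul_right (‖v‖ ^ (2 : ℝ≥0∞).toReal)).congr fun α => ?_
  rw [Real.mul_rpow (norm_nonneg _) (norm_nonneg _)]

/-- The vector `h ⊗ v = ∑_α b_α ⊗ ⟨h, b_α⟩ v` of `H ⊗₂ V`. -/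
def ellTwoTmul (h : H) (v : V) : EllTwo ι V := ⟨fun α => b.repr h α • v, memlp_tmul b h v⟩

/-- The pairing `⟨w, k̄ ⊗ η⟩ = ∑_α ⟨b_α, k⟩ ⟨w_α, η⟩` of `w = ∑_α b_α ⊗ w_α` in `H ⊗₂ V` with
`k̄ ⊗ η`, `k ∈ H`, `η ∈ V*`. -/
def pairing (z : EllTwo ι V) (k : H) (η : StrongDual ℂ V) : ℂ :=
  ∑' α, ⟪k, b α⟫_ℂ * η (z α)

theorem summable_pairing (z : EllTwo ι V) (k : H) (η : StrongDual ℂ V) :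
    Summable fun α => ⟪k, b α⟫_ℂ * η (z α) := by
  have hk := lp.memℓp (b.repr k)
  have hz := lp.memℓp z
  rw [memℓp_gen_iff (by norm_num)] at hk hz
  refine Summable.of_norm_bounded
    (g := fun α => ‖b.repr k α‖ ^ (2 : ℝ≥0∞).toReal + ‖η‖ ^ 2 * ‖z α‖ ^ (2 : ℝ≥0∞).toReal)
    (hk.add (hz.mul_left _)) fun α => ?_
  have h1 : ‖⟪k, b α⟫_ℂ‖ = ‖b.repr k α‖ := by rw [b.repr_apply_apply, norm_inner_symm]
  have h2 := η.le_opNorm (z α)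
  simp only [norm_mul, h1, ENNReal.toReal_ofNat, Real.rpow_ofNat]
  nlinarith [sq_nonneg (‖b.repr k α‖ - ‖η‖ * ‖z α‖), norm_nonneg (b.repr k α),
    norm_nonneg (η (z α)), norm_nonneg (z α), norm_nonneg η,
    mul_le_mul_of_nonneg_left h2 (norm_nonneg (b.repr k α)),
    mul_nonneg (norm_nonneg (b.repr k α)) (mul_nonneg (norm_nonneg η) (norm_nonneg (z α)))]

/-- `U ∈ B(H ⊗₂ V)` is a generator of `π`:
`⟨U (h ⊗ v), k̄ ⊗ η⟩ = ⟨π(μ_{k,h}) v, η⟩` for all `h, k ∈ H`, `v ∈ V`, `η ∈ V*`. -/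
def IsGenerator (π : Predual M →L[ℂ] (V →L[ℂ] V)) (U : EllTwo ι V →L[ℂ] EllTwo ι V) : Prop :=
  ∀ (h k : H) (v : V) (η : StrongDual ℂ V),
    pairing b (U (ellTwoTmul b h v)) k η = η (π (vectorNormal M k h) v)

/-- The space `WAP_{iso,l}(M)`: the coefficients `μ ↦ ⟨ξ(μ), η⟩` of the left covariant
representations `(π, ξ)` of `M_*` on reflexive Banach spaces such that `π` is `ℓ₂`-contractive and
its generator is isometric onto. -/
def WAPIsoLeft (Δ : Comultiplication M) : Set M :=
  {x | ∃ (V : Type w) (_ : NormedAddCommGroup V) (_ : NormedSpace ℂ V) (_ : CompleteSpace V)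
    (R : LeftCovariantRep Δ V) (η : StrongDual ℂ V),
    IsReflexive V ∧ IsL2Contractive R.π ∧
    (∃ U : EllTwo ι V →L[ℂ] EllTwo ι V,
      IsGenerator b R.π U ∧ Isometry U ∧ Function.Surjective U) ∧
    ∀ μ : Predual M, toDual μ x = η (R.ξ μ)}

end Representations

end HopfVN

end

/-!
The isometric generator and `ℓ₂`-contractivity together force `V` to be a Hilbert space when
`dim H ≥ 2`. For orthonormal families `(k_i)`, `(h_j)` in `H` the matrix `(μ_{k_i, h_j})` is
contractive in `M_n(M_*)`, and this does not refer to the fixed basis of `H`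
(`HopfVN.dualMatrixNorm_vectorNormal_le_one`). So the generator `U` satisfies
`‖U (h₁ ⊗ v + h₂ ⊗ w)‖² ≤ ‖v‖² + ‖w‖²` for every orthonormal pair `h₁, h₂`, while `U` preserves the
norm of `H ⊗₂ V`, which does refer to the basis. Comparing the two for a pair obtained by rotating
two basis vectors by `π / 4` gives the parallelogram law in `V`
(`HopfVN.parallelogram_le_of_isometry_generator`).

The closure `C` of `{ξ(μ) : μ ∈ P}` is convex, and the contractions `π(μ)`, `μ ∈ P`, map it into
itself by covariance. In a Hilbert space the unique element `v` of minimal norm of `C` is therefore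
fixed by all of them (`exists_fixed_of_parallelogram_le`), and `π(ν) v = ν(1) v` for every vector
functional `ν` by polarization. As `ν(μ.x) = ⟨π(ν) ξ(μ), η⟩`, the elements `μ.x` with `ξ(μ) → v`
converge in norm to `⟨v, η⟩ 1` (`HopfVN.LeftCovariantRep.norm_act_sub_le`).

If `dim H = 1`, then `M = ℂ 1` and there is nothing to average.
-/

namespace HopfVN

/-! ### Matrices of vector functionals -/

section MatrixNorm

variable {H : Type u} [NormedAddCommGroup H] [InnerProductSpace ℂ H] [CompleteSpace H]

/-- The matrix `(μ_{k_i, h_j})` is contractive in `M_n(M_*)` if `(k_i)` satisfies Bessel's inequality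
and `(h_j)` the dual inequality: its value at `x ∈ M_n(M)` is the compression of
`x`, acting on `H ⊗ ℓ_{2,n}`, by the contractions `ℓ_{2,n} → H` with columns `k_i` and `h_j`. -/
theorem dualMatrixNorm_vectorNormal_le_one (M : VonNeumannAlgebra H) {n : ℕ} (k h : Fin n → H)
    (hk : ∀ y : H, ∑ i, ‖⟪k i, y⟫_ℂ‖ ^ 2 ≤ ‖y‖ ^ 2)
    (hh : ∀ c : Fin n → ℂ, ‖∑ j, c j • h j‖ ^ 2 ≤ ∑ j, ‖c j‖ ^ 2) :
    dualMatrixNorm (Matrix.of fun i j => vectorNormal M (k i) (h j)) ≤ 1 := by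
  refine iSup₂_le fun x hx => ?_
  rw [← ofReal_norm, ENNReal.ofReal_le_one]
  refine ContinuousLinearMap.opNorm_le_bound _ zero_le_one fun c => ?_
  rw [one_mul]
  refine le_of_sq_le_sq ?_ (norm_nonneg _)
  set z : PiLp 2 (fun _ : Fin n => H) := WithLp.toLp 2 fun l => ∑ j, c (j, l) • h j with hz
  set X := matrixOp (x.map fun y => (y : H →L[ℂ] H))
  have hXz : ‖X z‖ ≤ ‖z‖ := X.le_of_opNorm_le_of_le hx le_rfl |>.trans (one_mul _).le
  have hcoord : ∀ i l, Matrix.toEuclideanCLM (n := Fin n × Fin n) (𝕜 := ℂ)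
      (Matrix.of fun p q => toDual (Matrix.of (fun i j => vectorNormal M (k i) (h j)) p.1 q.1)
        (x p.2 q.2)) c (i, l) = ⟪k i, X z l⟫_ℂ := by
    intro i l
    rw [Matrix.ofLp_toEuclideanCLM, matrixOp_apply, Matrix.mulVec, dotProduct,
      Fintype.sum_prod_type_right, inner_sum]
    refine Finset.sum_congr rfl fun m _ => ?_
    simp only [hz, map_sum, map_smul, inner_sum, inner_smul_right]
    exact Finset.sum_congr rfl fun j _ => mul_comm _ _
  calc _ = ∑ l, ∑ i, ‖⟪k i, X z l⟫_ℂ‖ ^ 2 := by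
        rw [EuclideanSpace.norm_sq_eq, Fintype.sum_prod_type_right]
        simp only [hcoord]
    _ ≤ ∑ l, ‖X z l‖ ^ 2 := Finset.sum_le_sum fun l _ => hk _
    _ = ‖X z‖ ^ 2 := (PiLp.norm_sq_eq_of_L2 _ _).symm
    _ ≤ ‖z‖ ^ 2 := by gcongr
    _ = ∑ l, ‖∑ j, c (j, l) • h j‖ ^ 2 := PiLp.norm_sq_eq_of_L2 _ _
    _ ≤ ∑ l, ∑ j, ‖c (j, l)‖ ^ 2 := Finset.sum_le_sum fun l _ => hh _
    _ = ‖c‖ ^ 2 := by rw [EuclideanSpace.norm_sq_eq, Fintype.sum_prod_type_right]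

end MatrixNorm

/-! ### Isometric generators and the parallelogram law -/

section Generator

variable {H : Type u} [NormedAddCommGroup H] [InnerProductSpace ℂ H] [CompleteSpace H]
  {M : VonNeumannAlgebra H} {ι : Type v} (b : HilbertBasis ι ℂ H) {V : Type w}
  [NormedAddCommGroup V] [NormedSpace ℂ V]

/-- An `ℓ₂`-contractive map satisfies a column estimate for every pair `h₁, h₂` which is the image of
the basis under a contraction `ℓ_{2,2} → H`, not only pairs taken from the fixed basis. -/
theorem IsL2Contractive.sum_norm_sq_le {π : Predual M →L[ℂ] (V →L[ℂ] V)} (hπ : IsL2Contractive π)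
    {h₁ h₂ : H} (hh : ∀ c d : ℂ, ‖c • h₁ + d • h₂‖ ^ 2 ≤ ‖c‖ ^ 2 + ‖d‖ ^ 2) (v w : V)
    (F : Finset ι) :
    ∑ α ∈ F, ‖π (vectorNormal M (b α) h₁) v + π (vectorNormal M (b α) h₂) w‖ ^ 2 ≤
      ‖v‖ ^ 2 + ‖w‖ ^ 2 := by
  -- Padding with zeros makes the `F × 2` matrix `(μ_{b_α, h_j})` a square one.
  let k : Fin (F.card + 2) → H := Fin.append (fun i => b (F.equivFin.symm i)) 0
  let h : Fin (F.card + 2) → H := Fin.append 0 ![h₁, h₂]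
  let z : PiLp 2 (fun _ : Fin (F.card + 2) => V) := WithLp.toLp 2 (Fin.append 0 ![v, w])
  have hF : ∀ f : ι → ℝ, ∑ i : Fin F.card, f (F.equivFin.symm i) = ∑ α ∈ F, f α := fun f =>
    (Equiv.sum_comp F.equivFin.symm fun α : F => f α).trans (Finset.sum_coe_sort F f)
  have hnorm := dualMatrixNorm_vectorNormal_le_one M k h
    (fun y => by
      simp only [k, Fin.sum_univ_add, Fin.append_left, Fin.append_right]
      rw [hF fun α => ‖⟪b α, y⟫_ℂ‖ ^ 2]
      simpa using b.orthonormal.sum_inner_products_le y)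
    (fun c => by
      simp only [h, Fin.sum_univ_add, Fin.append_left, Fin.append_right, Fin.sum_univ_two,
        Pi.zero_apply, smul_zero, Finset.sum_const_zero, zero_add]
      refine (hh _ _).trans ?_
      have : 0 ≤ ∑ i : Fin F.card, ‖c (Fin.castAdd 2 i)‖ ^ 2 := by positivity
      linarith)
  have hA := (hπ _ _).trans hnorm
  rw [← ofReal_norm, ENNReal.ofReal_le_one] at hA
  have hle := ContinuousLinearMap.le_of_opNorm_le _ hA z
  rw [one_mul] at hle
  have hsq := pow_le_pow_left₀ (norm_nonneg _) hle 2
  rw [PiLp.norm_sq_eq_of_L2, PiLp.norm_sq_eq_of_L2] at hsq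
  simp only [matrixOp_apply, Matrix.map_apply, Matrix.of_apply, Fin.sum_univ_add, z, h, k,
    Fin.append_left, Fin.append_right, Fin.sum_univ_two, Pi.zero_apply, map_zero,
    Finset.sum_const_zero, zero_add, norm_zero] at hsq
  rw [← hF fun α => ‖π (vectorNormal M (b α) h₁) v + π (vectorNormal M (b α) h₂) w‖ ^ 2]
  refine le_trans ?_ (hsq.trans (by simp))
  exact le_add_of_nonneg_right (by positivity)

theorem pairing_basis (z : EllTwo ι V) (α : ι) (η : StrongDual ℂ V) :
    pairing b z (b α) η = η (z α) := by
  classical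
  rw [pairing, tsum_eq_single α]
  · simp [b.orthonormal.1 α]
  · intro β hβ
    rw [b.orthonormal.2 hβ.symm, zero_mul]

/-- The coordinates of a generator: `U (h ⊗ v) = ∑_α b_α ⊗ π(μ_{b_α, h}) v`. -/
theorem IsGenerator.apply_tmul {π : Predual M →L[ℂ] (V →L[ℂ] V)}
    {U : EllTwo ι V →L[ℂ] EllTwo ι V} (hU : IsGenerator b π U) (h : H) (v : V) (α : ι) :
    U (ellTwoTmul b h v) α = π (vectorNormal M (b α) h) v := by
  refine (SeparatingDual.eq_iff_forall_dual_eq (R := ℂ)).2 fun η => ?_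
  rw [← pairing_basis b, hU]

theorem IsGenerator.norm_sq_apply_add_le {π : Predual M →L[ℂ] (V →L[ℂ] V)}
    (hπ : IsL2Contractive π) {U : EllTwo ι V →L[ℂ] EllTwo ι V} (hU : IsGenerator b π U)
    {h₁ h₂ : H} (hh : ∀ c d : ℂ, ‖c • h₁ + d • h₂‖ ^ 2 ≤ ‖c‖ ^ 2 + ‖d‖ ^ 2) (v w : V) :
    ‖U (ellTwoTmul b h₁ v + ellTwoTmul b h₂ w)‖ ^ 2 ≤ ‖v‖ ^ 2 + ‖w‖ ^ 2 := by
  have hnn : 0 ≤ ‖v‖ ^ 2 + ‖w‖ ^ 2 := by positivity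
  have : ‖U (ellTwoTmul b h₁ v + ellTwoTmul b h₂ w)‖ ≤ √(‖v‖ ^ 2 + ‖w‖ ^ 2) := by
    refine lp.norm_le_of_forall_sum_le (by norm_num) (Real.sqrt_nonneg _) fun F => ?_
    simp only [ENNReal.toReal_ofNat, Real.rpow_ofNat, Real.sq_sqrt hnn]
    refine le_trans (le_of_eq ?_) (hπ.sum_norm_sq_le b hh v w F)
    refine Finset.sum_congr rfl fun α _ => ?_
    rw [map_add, lp.coeFn_add, Pi.add_apply, hU.apply_tmul b, hU.apply_tmul b]
  exact (pow_le_pow_left₀ (norm_nonneg _) this 2).trans (Real.sq_sqrt hnn).le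

/-- An `ℓ₂`-contractive map with an isometric generator lives on a Hilbert space, as soon as
`dim H ≥ 2`. The generator sends the vector
`b_α ⊗ (v + w)/√2 + b_β ⊗ (v - w)/√2 = h₁ ⊗ v + h₂ ⊗ w`, `h_{1,2} = (b_α ± b_β)/√2`,
to a vector of norm at most `(‖v‖² + ‖w‖²)^{1/2}`, and it preserves the norm. -/
theorem parallelogram_le_of_isometry_generator {π : Predual M →L[ℂ] (V →L[ℂ] V)}
    (hπ : IsL2Contractive π) {U : EllTwo ι V →L[ℂ] EllTwo ι V} (hU : IsGenerator b π U)
    (hiso : Isometry U) {α β : ι} (hαβ : α ≠ β) (v w : V) :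
    ‖v + w‖ ^ 2 + ‖v - w‖ ^ 2 ≤ 2 * (‖v‖ ^ 2 + ‖w‖ ^ 2) := by
  classical
  obtain ⟨s, hs⟩ : ∃ s : ℂ, ‖s‖ ^ 2 = 1 / 2 := by
    refine ⟨((√2 : ℝ) : ℂ)⁻¹, ?_⟩
    rw [norm_inv, Complex.norm_real, inv_pow, Real.norm_eq_abs, sq_abs,
      Real.sq_sqrt zero_le_two, one_div]
  have hαα : ⟪b α, b α⟫_ℂ = 1 := by simp [b.orthonormal.1 α]
  have hββ : ⟪b β, b β⟫_ℂ = 1 := by simp [b.orthonormal.1 β]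
  have h01 : ⟪b α, b β⟫_ℂ = 0 := b.orthonormal.2 hαβ
  have h10 : ⟪b β, b α⟫_ℂ = 0 := b.orthonormal.2 hαβ.symm
  have hh : ∀ c d : ℂ, ‖c • (s • (b α + b β)) + d • (s • (b α - b β))‖ ^ 2 ≤
      ‖c‖ ^ 2 + ‖d‖ ^ 2 := by
    intro c d
    have h1 : c • (s • (b α + b β)) + d • (s • (b α - b β)) =
        s • ((c + d) • b α + (c - d) • b β) := by module
    have h2 : ‖(c + d) • b α + (c - d) • b β‖ * ‖(c + d) • b α + (c - d) • b β‖ =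
        ‖c + d‖ * ‖c + d‖ + ‖c - d‖ * ‖c - d‖ := by
      rw [norm_add_sq_eq_norm_sq_add_norm_sq_of_inner_eq_zero (𝕜 := ℂ) _ _
        (by simp [inner_smul_left, inner_smul_right, h01])]
      simp [norm_smul, b.orthonormal.1]
    have h3 := parallelogram_law_with_norm ℝ c d
    rw [h1, norm_smul, mul_pow, hs]
    linarith [sq ‖(c + d) • b α + (c - d) • b β‖, sq ‖c‖, sq ‖d‖]
  have hle := hU.norm_sq_apply_add_le b hπ hh v w
  rw [hiso.norm_map_of_map_zero (map_zero U)] at hle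
  have hco := lp.sum_rpow_le_norm_rpow (p := 2) (by norm_num)
    (ellTwoTmul b (s • (b α + b β)) v + ellTwoTmul b (s • (b α - b β)) w) {α, β}
  have hcα : (ellTwoTmul b (s • (b α + b β)) v + ellTwoTmul b (s • (b α - b β)) w) α =
      s • (v + w) := by
    change b.repr (s • (b α + b β)) α • v + b.repr (s • (b α - b β)) α • w = _
    rw [b.repr_apply_apply, b.repr_apply_apply, inner_smul_right, inner_smul_right, inner_add_right,
      inner_sub_right, hαα, h01]
    module
  have hcβ : (ellTwoTmul b (s • (b α + b β)) v + ellTwoTmul b (s • (b α - b β)) w) β =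
      s • (v - w) := by
    change b.repr (s • (b α + b β)) β • v + b.repr (s • (b α - b β)) β • w = _
    rw [b.repr_apply_apply, b.repr_apply_apply, inner_smul_right, inner_smul_right, inner_add_right,
      inner_sub_right, hββ, h10]
    module
  rw [Finset.sum_pair hαβ, hcα, hcβ] at hco
  simp only [ENNReal.toReal_ofNat, Real.rpow_ofNat, norm_smul, mul_pow, hs] at hco
  linarith

end Generator

end HopfVN

/-! ### Elements of minimal norm -/

section MinimalNorm

/-- In a Banach space satisfying the parallelogram inequality, a nonempty closed convex set has a unique
element of minimal norm, so every norm-decreasing map of the set into itself fixes this element. -/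
theorem exists_fixed_of_parallelogram_le {V : Type*} [NormedAddCommGroup V] [NormedSpace ℝ V]
    [CompleteSpace V] (hV : ∀ v w : V, ‖v + w‖ ^ 2 + ‖v - w‖ ^ 2 ≤ 2 * (‖v‖ ^ 2 + ‖w‖ ^ 2))
    {C : Set V} (hne : C.Nonempty) (hcl : IsClosed C) (hconv : Convex ℝ C) :
    ∃ v ∈ C, ∀ T : V → V, Set.MapsTo T C C → ‖T v‖ ≤ ‖v‖ → T v = v := by
  have heq : ∀ v w : V, ‖v + w‖ * ‖v + w‖ + ‖v - w‖ * ‖v - w‖ =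
      2 * (‖v‖ * ‖v‖ + ‖w‖ * ‖w‖) := by
    intro v w
    have h1 := hV v w
    -- The reverse inequality is the given one for `v + w` and `v - w`.
    have h2 := hV (v + w) (v - w)
    have h3 : v + w + (v - w) = (2 : ℝ) • v := by module
    have h4 : v + w - (v - w) = (2 : ℝ) • w := by module
    rw [h3, h4, norm_smul, norm_smul, Real.norm_ofNat] at h2
    nlinarith
  let _ := InnerProductSpace.ofNorm ℝ heq
  obtain ⟨v, hv, hmin⟩ := exists_norm_eq_iInf_of_complete_convex hne hcl.isComplete hconv 0
  simp only [zero_sub, norm_neg] at hmin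
  have hle : ∀ y ∈ C, ‖v‖ ≤ ‖y‖ := fun y hy => by
    rw [hmin]
    exact ciInf_le (f := fun z : C => ‖(z : V)‖) ⟨0, by rintro _ ⟨z, rfl⟩; positivity⟩ ⟨y, hy⟩
  refine ⟨v, hv, fun T hT hTv => ?_⟩
  have hmid := hle _ (hconv hv (hT hv) (by norm_num : (0 : ℝ) ≤ 1 / 2)
    (by norm_num : (0 : ℝ) ≤ 1 / 2) (by norm_num))
  rw [← smul_add, norm_smul, Real.norm_of_nonneg (by norm_num)] at hmid
  have hp := heq v (T v)
  -- The midpoint of `v` and `T v` lies in `C`, so its norm is at least `‖v‖`.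
  have hz : ‖v - T v‖ = 0 := by
    nlinarith [norm_nonneg v, norm_nonneg (T v), norm_nonneg (v - T v)]
  exact (sub_eq_zero.1 (norm_eq_zero.1 hz)).symm

end MinimalNorm

namespace HopfVN

/-! ### Normal states and orbits -/

section States

variable {H : Type u} [NormedAddCommGroup H] [InnerProductSpace ℂ H] [CompleteSpace H]
  {M : VonNeumannAlgebra H}

theorem toDual_vectorNormal (M : VonNeumannAlgebra H) (k h : H) (x : M) :
    toDual (vectorNormal M k h) x = ⟪k, (x : H →L[ℂ] H) h⟫_ℂ := rfl

theorem norm_vectorNormal_le (M : VonNeumannAlgebra H) (k h : H) :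
    ‖vectorNormal M k h‖ ≤ ‖k‖ * ‖h‖ := by
  rw [← (toDual (M := M)).norm_map]
  refine ContinuousLinearMap.opNorm_le_bound _ (by positivity) fun x => ?_
  rw [toDual_vectorNormal]
  calc _ ≤ ‖k‖ * ‖(x : H →L[ℂ] H) h‖ := norm_inner_le_norm _ _
    _ ≤ ‖k‖ * (‖x‖ * ‖h‖) := by gcongr; exact (x : H →L[ℂ] H).le_opNorm h
    _ = _ := by ring

theorem vectorNormal_mem_normalStates (M : VonNeumannAlgebra H) {h : H} (hh : ‖h‖ = 1) :
    vectorNormal M h h ∈ normalStates M := by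
  refine ⟨(norm_vectorNormal_le M h h).trans (by simp [hh]), ?_⟩
  rw [toDual_vectorNormal]
  simp [hh]

theorem normalStates_nonempty [Nontrivial H] : (normalStates M).Nonempty :=
  let ⟨_, hh⟩ := exists_norm_eq H zero_le_one
  ⟨_, vectorNormal_mem_normalStates M hh⟩

theorem convex_normalStates : Convex ℝ (normalStates M) := by
  rintro μ ⟨hμ, hμ1⟩ ν ⟨hν, hν1⟩ s t hs ht hst
  refine ⟨?_, ?_⟩
  · refine (norm_add_le _ _).trans ?_
    rw [norm_smul, norm_smul, Real.norm_of_nonneg hs, Real.norm_of_nonneg ht]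
    nlinarith
  · rw [← Complex.coe_smul, ← Complex.coe_smul, map_add, map_smul, map_smul]
    simp only [add_apply, smul_apply, hμ1, hν1, smul_eq_mul,
      mul_one]
    exact_mod_cast hst

theorem slice_one (μ : StrongDual ℂ M) : slice μ 1 = μ 1 • (1 : M) := by
  refine ext_of_inner fun k h => ?_
  have : sliceVecLeft M k h 1 = ⟪k, h⟫_ℂ • (1 : M) := ext_of_inner fun q p => by
    change ⟪q, vecSliceLeft k h 1 p⟫_ℂ = ⟪q, ⟪k, h⟫_ℂ • p⟫_ℂ
    rw [inner_vecSliceLeft, inner_smul_right]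
    exact inner_elemTensor k q h p
  rw [inner_slice, this, map_smul]
  change _ = ⟪k, μ 1 • h⟫_ℂ
  rw [inner_smul_right, smul_eq_mul, mul_comm]

theorem act_one (Δ : Comultiplication M) (μ : Predual M) : act Δ μ 1 = toDual μ 1 • (1 : M) := by
  rw [act, map_one, slice_one]

theorem act_smul (Δ : Comultiplication M) (μ : Predual M) (c : ℂ) (x : M) :
    act Δ μ (c • x) = c • act Δ μ x := by
  rw [act, map_smul, map_smul, act]

theorem norm_conv_le (Δ : Comultiplication M) (μ ν : Predual M) : ‖conv Δ μ ν‖ ≤ ‖μ‖ * ‖ν‖ := by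
  rw [← (toDual (M := M)).norm_map]
  refine ContinuousLinearMap.opNorm_le_bound _ (by positivity) fun x => ?_
  rw [← apply_act, act]
  calc _ ≤ ‖μ‖ * ‖slice (toDual ν) (Δ.toHom x)‖ := (toDual μ).le_opNorm _
    _ ≤ ‖μ‖ * (‖ν‖ * ‖x‖) := by
        gcongr
        exact (norm_slice_le _ _).trans (mul_le_mul_of_nonneg_left
          (NonUnitalStarAlgHom.norm_apply_le Δ.toHom x) (norm_nonneg _))
    _ = _ := by ring

theorem conv_mem_normalStates (Δ : Comultiplication M) {μ ν : Predual M} (hμ : μ ∈ normalStates M)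
    (hν : ν ∈ normalStates M) : conv Δ μ ν ∈ normalStates M := by
  refine ⟨(norm_conv_le Δ μ ν).trans (mul_le_one₀ hμ.1 (norm_nonneg _) hν.1), ?_⟩
  rw [← apply_act, act_one, hν.2, one_smul, hμ.2]

theorem vectorNormal_polarization (M : VonNeumannAlgebra H) (k h : H) :
    vectorNormal M k h = (1 / 4 : ℂ) • (vectorNormal M (h + k) (h + k) -
      vectorNormal M (h - k) (h - k) + Complex.I • vectorNormal M (h + Complex.I • k)
        (h + Complex.I • k) - Complex.I • vectorNormal M (h - Complex.I • k)
        (h - Complex.I • k)) := by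
  apply (toDual (M := M)).injective
  ext x
  simp only [map_smul, map_add, map_sub, smul_apply,
    add_apply, sub_apply, toDual_vectorNormal,
    inner_add_left, inner_add_right, inner_sub_left, inner_sub_right, inner_smul_left,
    inner_smul_right, Complex.conj_I, smul_eq_mul]
  ring_nf
  simp only [Complex.I_sq]
  ring

/-- A vector fixed by all normal states is fixed by all vector functionals, up to their value
at `1`. -/
theorem apply_vectorNormal_of_fixed {V : Type w} [NormedAddCommGroup V] [NormedSpace ℂ V]
    (π : Predual M →L[ℂ] (V →L[ℂ] V)) {v : V} (hv : ∀ μ ∈ normalStates M, π μ v = v) (k h : H) :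
    π (vectorNormal M k h) v = toDual (vectorNormal M k h) 1 • v := by
  let N : Submodule ℂ (Predual M) :=
    { carrier := {ν | π ν v = toDual ν 1 • v}
      zero_mem' := by simp
      add_mem' := fun {μ ν} hμ hν => by
        simp only [Set.mem_ofPred_eq] at hμ hν ⊢
        simp [hμ, hν, add_smul]
      smul_mem' := fun c ν hν => by
        simp only [Set.mem_ofPred_eq] at hν ⊢
        simp [hν, mul_smul] }
  -- A diagonal vector functional is a multiple of a vector state; `N` contains the others by
  -- polarization.
  have hdiag : ∀ p : H, vectorNormal M p p ∈ N := by
    intro p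
    have hp : vectorNormal M p p = ((‖p‖ : ℂ) ^ 2) •
        vectorNormal M (((‖p‖ : ℂ)⁻¹) • p) (((‖p‖ : ℂ)⁻¹) • p) := by
      apply (toDual (M := M)).injective
      ext x
      rw [map_smul, smul_apply, toDual_vectorNormal, toDual_vectorNormal,
        map_smul, inner_smul_left, inner_smul_right, map_inv₀, Complex.conj_ofReal, smul_eq_mul]
      rcases eq_or_ne p 0 with rfl | h0
      · simp
      · have : (‖p‖ : ℂ) ≠ 0 := by simpa using h0
        field_simp
    rcases eq_or_ne p 0 with rfl | h0
    · rw [hp]; simp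
    · rw [hp]
      refine N.smul_mem _ ?_
      have hst : vectorNormal M (((‖p‖ : ℂ)⁻¹) • p) (((‖p‖ : ℂ)⁻¹) • p) ∈ normalStates M :=
        vectorNormal_mem_normalStates M (norm_smul_inv_norm (𝕜 := ℂ) h0)
      change π _ v = toDual _ 1 • v
      rw [hv _ hst, hst.2, one_smul]
  have : vectorNormal M k h ∈ N := by
    rw [vectorNormal_polarization]
    exact N.smul_mem _ (N.sub_mem (N.add_mem (N.sub_mem (hdiag _) (hdiag _))
      (N.smul_mem _ (hdiag _))) (N.smul_mem _ (hdiag _)))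
  exact this

/-- A functional on a vector `v` fixed by the normal states gives a constant near the orbit of the
coefficient, since `(ν μ)(x) = ⟨π(ν) ξ(μ), η⟩` is close to `⟨π(ν) v, η⟩ = ν(1) ⟨v, η⟩` when `ξ(μ)`
is close to `v`. -/
theorem LeftCovariantRep.norm_act_sub_le {Δ : Comultiplication M} {V : Type w}
    [NormedAddCommGroup V] [NormedSpace ℂ V] (R : LeftCovariantRep Δ V) (η : StrongDual ℂ V)
    {x : M} (hx : ∀ μ : Predual M, toDual μ x = η (R.ξ μ)) {v : V}
    (hv : ∀ μ ∈ normalStates M, R.π μ v = v) (μ : Predual M) :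
    ‖act Δ μ x - η v • (1 : M)‖ ≤ ‖η‖ * ‖R.ξ μ - v‖ := by
  set y := act Δ μ x - η v • (1 : M) with hy
  change ‖(y : H →L[ℂ] H)‖ ≤ _
  refine ContinuousLinearMap.opNorm_le_bound _ (by positivity) fun h => ?_
  set k := (y : H →L[ℂ] H) h with hk
  have hval : ⟪k, (y : H →L[ℂ] H) h⟫_ℂ = η (R.π (vectorNormal M k h) (R.ξ μ - v)) := by
    rw [← toDual_vectorNormal, hy, map_sub, map_smul, apply_act, hx, R.covariant, map_sub,
      apply_vectorNormal_of_fixed R.π hv, map_sub, map_smul, smul_eq_mul, smul_eq_mul, mul_comm]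
  rw [← hk] at hval
  have hle : ‖k‖ * ‖k‖ ≤ ‖k‖ * (‖η‖ * ‖R.ξ μ - v‖ * ‖h‖) := by
    calc ‖k‖ * ‖k‖ = ‖⟪k, k⟫_ℂ‖ := by simp [inner_self_eq_norm_sq_to_K, sq]
      _ = ‖η (R.π (vectorNormal M k h) (R.ξ μ - v))‖ := by rw [hval]
      _ ≤ ‖η‖ * ((1 * (‖k‖ * ‖h‖)) * ‖R.ξ μ - v‖) := by
          refine η.le_opNorm_of_le ((R.π _).le_of_opNorm_le ?_ _)
          exact R.π.le_of_opNorm_le_of_le R.norm_π_le (norm_vectorNormal_le M k h)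
      _ = _ := by ring
  rcases (norm_nonneg k).eq_or_lt with h0 | h0
  · rw [← h0]; positivity
  · exact le_of_mul_le_mul_left hle h0

theorem LeftCovariantRep.norm_π_apply_le {Δ : Comultiplication M} {V : Type w}
    [NormedAddCommGroup V] [NormedSpace ℂ V] (R : LeftCovariantRep Δ V) {μ : Predual M}
    (hμ : μ ∈ normalStates M) (v : V) : ‖R.π μ v‖ ≤ ‖v‖ :=
  ((R.π μ).le_of_opNorm_le (R.π.le_of_opNorm_le_of_le R.norm_π_le hμ.1) v).trans (by simp)

/-- The element of minimal norm of the closure of `{ξ(μ) : μ ∈ P}` is fixed by `π(P)`, and pairing it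
with `η` gives the constant. -/
theorem exists_smul_one_mem_closure_of_parallelogram_le [Nontrivial H] {Δ : Comultiplication M}
    {V : Type w} [NormedAddCommGroup V] [NormedSpace ℂ V] [CompleteSpace V]
    (R : LeftCovariantRep Δ V) (η : StrongDual ℂ V) {x : M}
    (hx : ∀ μ : Predual M, toDual μ x = η (R.ξ μ))
    (hV : ∀ v w : V, ‖v + w‖ ^ 2 + ‖v - w‖ ^ 2 ≤ 2 * (‖v‖ ^ 2 + ‖w‖ ^ 2)) :
    ∃ c : ℂ, c • (1 : M) ∈ closure (stateOrbit Δ x) := by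
  have hconv : Convex ℝ (closure (R.ξ '' normalStates M)) :=
    (convex_normalStates.linear_image (R.ξ.restrictScalars ℝ).toLinearMap).closure
  obtain ⟨v, hvC, hfix⟩ := exists_fixed_of_parallelogram_le hV
    (normalStates_nonempty.image _).closure isClosed_closure hconv
  have hv : ∀ μ ∈ normalStates M, R.π μ v = v := by
    refine fun μ hμ => hfix _ ?_ (R.norm_π_apply_le hμ v)
    refine Set.MapsTo.closure ?_ (R.π μ).continuous
    rintro _ ⟨ν, hν, rfl⟩
    exact ⟨_, conv_mem_normalStates Δ hμ hν, R.covariant μ ν⟩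
  refine ⟨η v, Metric.mem_closure_iff.2 fun ε hε => ?_⟩
  obtain ⟨_, ⟨μ, hμ, rfl⟩, hd⟩ := Metric.mem_closure_iff.1 hvC (ε / (‖η‖ + 1)) (by positivity)
  refine ⟨_, ⟨μ, hμ, rfl⟩, ?_⟩
  rw [dist_comm, dist_eq_norm] at hd ⊢
  refine (R.norm_act_sub_le η hx hv μ).trans_lt ?_
  calc _ ≤ (‖η‖ + 1) * ‖R.ξ μ - v‖ := by gcongr; linarith
    _ < ε := by rwa [lt_div_iff₀' (by positivity)] at hd

/-- If `dim H = 1`, then `M = ℂ` and its elements are fixed by the states. -/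
theorem exists_smul_one_mem_closure_of_subsingleton [Nontrivial H] {ι : Type v} [Subsingleton ι]
    (b : HilbertBasis ι ℂ H) (Δ : Comultiplication M) (x : M) :
    ∃ c : ℂ, c • (1 : M) ∈ closure (stateOrbit Δ x) := by
  have hι : Nonempty ι := by
    by_contra hempty
    rw [not_nonempty_iff] at hempty
    obtain ⟨p, hp⟩ := exists_ne (0 : H)
    exact hp ((b.hasSum_repr p).unique hasSum_empty)
  obtain ⟨α⟩ := hι
  have hspan : ∀ p : H, b.repr p α • b α = p := fun p =>
    (hasSum_single α fun β hβ => (hβ (Subsingleton.elim _ _)).elim).unique (b.hasSum_repr p)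
  set c := b.repr ((x : H →L[ℂ] H) (b α)) α with hc
  have hx : x = c • (1 : M) := by
    apply Subtype.ext
    ext p
    change (x : H →L[ℂ] H) p = c • p
    rw [← hspan p, map_smul, smul_comm, hc, hspan]
  obtain ⟨μ, hμ⟩ := normalStates_nonempty (M := M)
  refine ⟨c, subset_closure ⟨μ, hμ, ?_⟩⟩
  rw [hx, act_smul, act_one, hμ.2, one_smul]

end States

end HopfVN

theorem mainTheorem4 {H : Type u} [NormedAddCommGroup H] [InnerProductSpace ℂ H] [CompleteSpace H]
    [Nontrivial H] {ι : Type v} (b : HilbertBasis ι ℂ H)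
    (M : VonNeumannAlgebra H) (Δ : HopfVN.Comultiplication M)
    (x : M) (hx : x ∈ HopfVN.WAPIsoLeft.{u, v, w} b Δ) :
    ∃ c : ℂ, c • (1 : M) ∈ closure (HopfVN.stateOrbit Δ x) := by
  obtain ⟨V, _, _, _, R, η, -, hπ, ⟨U, hU, hiso, -⟩, hx⟩ := hx
  rcases subsingleton_or_nontrivial ι with hι | hι
  · exact HopfVN.exists_smul_one_mem_closure_of_subsingleton b Δ x
  · obtain ⟨α, β, hαβ⟩ := exists_pair_ne ι
    exact HopfVN.exists_smul_one_mem_closure_of_parallelogram_le R η hx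
      (HopfVN.parallelogram_le_of_isometry_generator b hπ hU hiso hαβ)
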